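/- Let $1\le i\le n$, let $f\in\mathbb{R}[x_1,\dots,x_n]$ and let $\xi\in\mathbb{C}$ with $|\xi|=1$. For $h\in\mathbb{C}[x_1,\dots,x_n]$ write $\mathrm{crit}(V(h),\pi_i)=V\big(h,\frac{\partial h}{\partial x_{i+1}},\dots,\frac{\partial h}{\partial x_n}\big)\subset\mathbb{C}^n$. Assume that for every $t\in(0,1]$ the polar variety $\mathrm{crit}(V(f-t\xi),\pi_i)$ is either empty, or smooth and equidimensional of dimension $i-1$. Let $\lim_{t\to0}\mathrm{crit}(V(f-t\xi),\pi_i)\subset\mathbb{C}^n$ be the set of all limits of points $y_k\in \mathrm{crit}(V(f-t_k\xi),\pi_i)$ with $t_k\in(0,1]$, $t_k\to0$. Let $V$ be an irreducible component of this limit (a maximal irreducible algebraic subset of it) and let $z\in V$ be a nonsingular point of $V$. For a finite set $G\subset\mathbb{R}[x_1,\dots,x_n]$ and $p\in V(G)$, the isosingular deflation of $G$ at $p$ is the set $\mathcal{D}(G,p)$ that consists of $G$ and all $(\rho+1)\times(\rho+1)$ minors of the Jacobian matrix $JG$, where $\rho=\mathrm{rank}\,JG(p)$. Let $G_0\subset\mathbb{R}[x_1,\dots,x_n]$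 be a finite set that vanishes on $V$ and contains $f,\frac{\partial f}{\partial x_{i+1}},\dots,\frac{\partial f}{\partial x_n}$ (for example these polar equations themselves, or any witness system for $V$ that contains them). Let $k\ge0$, let $p\in V$, let $G_{j+1}=\mathcal{D}(G_j,p)$, and assume that $p$ is general in the sense that for each $j<k$ the rank of $JG_j$ at $p$ is the largest rank of $JG_j$ at a point of $V$. Let $F=G_k$, and assume that $\mathrm{rank}\,JF(z)=n-i+1$. Let $M(x)$ be an $(n-i+1)\times(n-i+1)$ submatrix of $JF(x)$ such that $M(z)$ is nonsingular, and let $g=\det M$. Then \begin{enumerate} \item $\mathrm{Sing}(V)\subset V(g)$; \item $\dim\big(V\cap V(g)\big)\le i-2$. \end{enumerate} Here the empty set has dimension $-1$, so that for $i=1$ the second claim says that $V\cap V(g)=\emptyset$. -/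

import Mathlib

open MvPolynomial

noncomputable section

/-- `V(G) ⊆ ℂⁿ`: the common complex zeros of a set `G` of polynomials
(with real or complex coefficients). -/
def commonZeros {R : Type} [CommRing R] [Algebra R ℂ] {n : ℕ}
    (G : Set (MvPolynomial (Fin n) R)) : Set (Fin n → ℂ) :=
  {x | ∀ h ∈ G, aeval x h = 0}

/-- The equations `h, ∂h/∂x_{i+1}, …, ∂h/∂x_n`. The variables are `x_1, …, x_n`; the variable
`x_{j+1}` is indexed by `j : Fin n`. -/
def polarEquations {R : Type} [CommRing R] {n : ℕ} (h : MvPolynomial (Fin n) R) (i : ℕ) :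
    Set (MvPolynomial (Fin n) R) :=
  {h} ∪ {q | ∃ j : Fin n, i ≤ j.val ∧ q = pderiv j h}

/-- The polar variety `crit(V(h), π_i)`. -/
def polarVariety {n : ℕ} (h : MvPolynomial (Fin n) ℂ) (i : ℕ) : Set (Fin n → ℂ) :=
  commonZeros (polarEquations h i)

/-- The polynomial `f - c` with complex coefficients, for a real polynomial `f` and `c ∈ ℂ`. -/
def perturb {n : ℕ} (f : MvPolynomial (Fin n) ℝ) (c : ℂ) : MvPolynomial (Fin n) ℂ :=
  map (algebraMap ℝ ℂ) f - C c

/-- The limit of a family of sets as `t → 0⁺`: all the limits of points `y_k ∈ S (t_k)` along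
sequences of parameters `t_k ∈ (0,1]` with `t_k → 0`. Limits at infinity are not included. -/
def limitAtZero {n : ℕ} (S : ℝ → Set (Fin n → ℂ)) : Set (Fin n → ℂ) :=
  {x | ∃ (t : ℕ → ℝ) (y : ℕ → Fin n → ℂ),
    (∀ k, 0 < t k ∧ t k ≤ 1 ∧ y k ∈ S (t k)) ∧
    Filter.Tendsto t Filter.atTop (nhds 0) ∧ Filter.Tendsto y Filter.atTop (nhds x)}

/-- A subset of `ℂⁿ` that is the zero set of polynomials and whose vanishing ideal is prime
(so it is not empty). -/
def IsIrreducibleAlgebraic {n : ℕ} (V : Set (Fin n → ℂ)) : Prop :=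
  zeroLocus ℂ (vanishingIdeal ℂ V) = V ∧ (vanishingIdeal ℂ V).IsPrime

/-- `V` is an irreducible component of `X`: a maximal irreducible algebraic subset of `X`. -/
def IsIrreducibleComponent {n : ℕ} (V X : Set (Fin n → ℂ)) : Prop :=
  Maximal (fun W => IsIrreducibleAlgebraic W ∧ W ⊆ X) V

/-- The dimension of an algebraic set: the Krull dimension of its coordinate ring.
The empty set has dimension `⊥`. -/
def algDim {n : ℕ} (V : Set (Fin n → ℂ)) : WithBot ℕ∞ :=
  ringKrullDim (MvPolynomial (Fin n) ℂ ⧸ vanishingIdeal ℂ V)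

/-- The gradient of a polynomial at a point of `ℂⁿ`. -/
def gradientAt {R : Type} [CommRing R] [Algebra R ℂ] {n : ℕ}
    (h : MvPolynomial (Fin n) R) (x : Fin n → ℂ) : Fin n → ℂ :=
  fun j => aeval x (pderiv j h)

/-- The tangent space `T_x(V)`: the vectors that are annihilated by the differentials at `x` of
all polynomials that vanish on `V`. -/
def tangentSpaceAt {n : ℕ} (V : Set (Fin n → ℂ)) (x : Fin n → ℂ) : Submodule ℂ (Fin n → ℂ) where
  carrier := {v | ∀ h ∈ vanishingIdeal ℂ V, gradientAt h x ⬝ᵥ v = 0}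
  zero_mem' := fun h _ => dotProduct_zero _
  add_mem' := fun {a b} ha hb h hh => by rw [dotProduct_add, ha h hh, hb h hh, add_zero]
  smul_mem' := fun c a ha h hh => by rw [dotProduct_smul, ha h hh, smul_zero]

/-- `x` is a nonsingular point of the equidimensional algebraic set `V`. -/
def IsNonsingularPoint {n : ℕ} (V : Set (Fin n → ℂ)) (x : Fin n → ℂ) : Prop :=
  x ∈ V ∧ (Module.finrank ℂ (tangentSpaceAt V x) : WithBot ℕ∞) = algDim V

/-- `Sing(V)`, for an equidimensional algebraic set `V`. -/
def singularLocus {n : ℕ} (V : Set (Fin n → ℂ)) : Set (Fin n → ℂ) :=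
  {x | x ∈ V ∧ ¬ IsNonsingularPoint V x}

/-- All irreducible components of `X` have dimension `d`. -/
def IsEquidimensional {n : ℕ} (X : Set (Fin n → ℂ)) (d : ℕ) : Prop :=
  ∀ W, IsIrreducibleComponent W X → algDim W = d

/-- The rank at `x` of the Jacobian matrix `JG` of a set `G` of polynomials: the dimension of the
row space of `JG(x)`. -/
def jacobianRank {n : ℕ} (G : Set (MvPolynomial (Fin n) ℝ)) (x : Fin n → ℂ) : ℕ :=
  Module.finrank ℂ (Submodule.span ℂ ((fun h => gradientAt h x) '' G))

/-- The `m × m` minor of a Jacobian matrix in which the rows are those of the polynomials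
`r 0, …, r (m-1)` and the columns those of the variables `c 0, …, c (m-1)`. -/
def jacobianMinor {n m : ℕ} (r : Fin m → MvPolynomial (Fin n) ℝ) (c : Fin m → Fin n) :
    MvPolynomial (Fin n) ℝ :=
  (Matrix.of fun a b => pderiv (c b) (r a)).det

/-- The isosingular deflation operator at the point `p`: it adjoins to `G` all
`(ρ+1) × (ρ+1)` minors of `JG`, where `ρ = rank JG(p)`. -/
def isosingularDeflation {n : ℕ} (p : Fin n → ℂ) (G : Set (MvPolynomial (Fin n) ℝ)) :
    Set (MvPolynomial (Fin n) ℝ) :=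
  G ∪ {q | ∃ (r : Fin (jacobianRank G p + 1) → MvPolynomial (Fin n) ℝ)
      (c : Fin (jacobianRank G p + 1) → Fin n),
      (∀ a, r a ∈ G) ∧ Function.Injective r ∧ StrictMono c ∧ q = jacobianMinor r c}

/-- The isosingular deflation sequence `G₀, G₁, G₂, …` of `G₀` at `p`. -/
def deflationSequence {n : ℕ} (p : Fin n → ℂ) (G₀ : Set (MvPolynomial (Fin n) ℝ)) (k : ℕ) :
    Set (MvPolynomial (Fin n) ℝ) :=
  (isosingularDeflation p)^[k] G₀

/-- `p` is a general point of `V` for the first `k` deflation steps: the Jacobian matrix of each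
system that is deflated has at `p` its generic, that is its largest, rank on `V`. -/
def IsGeneralPoint {n : ℕ} (V : Set (Fin n → ℂ)) (G₀ : Set (MvPolynomial (Fin n) ℝ)) (k : ℕ)
    (p : Fin n → ℂ) : Prop :=
  p ∈ V ∧ ∀ j < k, ∀ x ∈ V,
    jacobianRank (deflationSequence p G₀ j) x ≤ jacobianRank (deflationSequence p G₀ j) p

end

/-!
The point is that `V` has dimension `i - 1`. Once this is known, both claims are short. By induction
all terms of the deflation sequence vanish on `V`, since the rank of a Jacobian matrix on `V` is at most
its rank at the general point (`subset_commonZeros_deflationSequence`). At a point `x` of `V` at which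
`g` does not vanish there are thus `n - i + 1` equations of `V` with independent gradients, so
`dim T_x V ≤ i - 1` (`finrank_tangentSpaceAt_add_le`), while `dim T_x V ≥ dim V` holds everywhere
(`algDim_le_finrank_tangentSpaceAt`). Hence `x` is nonsingular. As `g` does not vanish at `z`, it cuts
the irreducible set `V` in a set of smaller dimension.

The same estimate at `z` gives `dim V ≤ i - 1`. For the other inequality, let `C` be the polar locus
`∂f/∂x_{i+1} = ⋯ = ∂f/∂x_n = 0`. All the polar varieties are level sets of `f` on `C`. The limit is the
union of the sets `C' ∩ V(f)` over the components `C'` of `C` on which `f` does not vanish identically: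
it is contained in this union because infinitely many terms of a sequence lie in the same component
(`exists_minimalPrimes_of_mem_limitAtZero`), and it contains the union because `f` restricted to `C'`
is open at its zeros in the classical topology (`mem_limitAtZero_of_mem_zeroLocus`). So `V` is a
component of some `C' ∩ V(f)`, and Krull's height theorem gives `dim C' ≥ i` and `dim V ≥ i - 1`.

The dimension theory of affine domains over `ℂ` rests on the equality of the heights of all maximal
ideals (`Ideal.IsMaximal.height_eq_ringKrullDim`), which follows from Noether normalization and going
down. For the openness of `f` at a zero `x` (`eventually_exists_mem_zeroLocus_aeval_eq`), the variety is
first replaced by an irreducible affine variety on which `x` is the only zero of `f`. In a Noether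
normalization of this variety, the roots of the minimal polynomial of `f` at a point are the values
of `f` on the fibre. For small `w`, a point close to the image of `x` with root `w` is found on a
line, by continuity of the roots of a polynomial in one variable; since the normalization is a proper
map, a point above it at which `f = w` is close to `x`.
-/

/-! ### Dimension of affine domains -/

/-- The maximal ideals of `ℂ[x₁, …, xₛ]` all have height `s`: some maximal ideal has this height,
and translations act transitively on them. -/
lemma MvPolynomial.height_vanishingIdeal_singleton {s : ℕ} (x : Fin s → ℂ) :
    (vanishingIdeal ℂ {x}).height = s := by
  have hdim : ringKrullDim (MvPolynomial (Fin s) ℂ) = s := by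
    simp [MvPolynomial.ringKrullDim_of_isNoetherianRing]
  have : FiniteRingKrullDim (MvPolynomial (Fin s) ℂ) := by
    rw [finiteRingKrullDim_iff_ne_bot_and_top, hdim]
    exact ⟨WithBot.natCast_ne_bot s, fun h => ENat.natCast_ne_top s (WithBot.coe_injective h)⟩
  obtain ⟨m, hm, hmh⟩ := Ideal.exists_isMaximal_height (R := MvPolynomial (Fin s) ℂ)
  obtain ⟨y, rfl⟩ := (isMaximal_iff_eq_vanishingIdeal_singleton (K := ℂ)).1 hm
  let T (v : Fin s → ℂ) : MvPolynomial (Fin s) ℂ →ₐ[ℂ] MvPolynomial (Fin s) ℂ :=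
    aeval fun j => X j + C (v j)
  have hT (v w : Fin s → ℂ) (h : v + w = 0) : (T v).comp (T w) = AlgHom.id ℂ _ := by
    ext1 j
    have : v j + w j = 0 := congrFun h j
    simp [T, add_assoc, ← C_add, this]
  let e : MvPolynomial (Fin s) ℂ ≃ₐ[ℂ] MvPolynomial (Fin s) ℂ :=
    AlgEquiv.ofAlgHom (T (x - y)) (T (y - x)) (hT _ _ (by abel)) (hT _ _ (by abel))
  have hcomap : (vanishingIdeal ℂ {y}).comap e.toRingEquiv = vanishingIdeal ℂ {x} := by
    ext p
    rw [Ideal.mem_comap, mem_vanishingIdeal_singleton_iff, mem_vanishingIdeal_singleton_iff]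
    have : (aeval y : MvPolynomial (Fin s) ℂ →ₐ[ℂ] ℂ).comp (T (x - y)) = aeval x := by
      ext1 j
      simp [T]
    rw [← this]
    rfl
  rw [← hcomap, RingEquiv.height_comap]
  rw [hdim] at hmh
  exact_mod_cast hmh

/-- An affine domain over `ℂ` has the same dimension at each of its closed points. By Noether
normalization and going down, this reduces to the case of a polynomial ring. -/
lemma Ideal.IsMaximal.height_eq_ringKrullDim {B : Type} [CommRing B] [IsDomain B] [Algebra ℂ B]
    [Algebra.FiniteType ℂ B] (m : Ideal B) [hm : m.IsMaximal] :
    (m.height : WithBot ℕ∞) = ringKrullDim B := by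
  obtain ⟨s, g, hg, hfin⟩ := exists_finite_inj_algHom_of_fg ℂ B
  let := g.toRingHom.toAlgebra
  have : Module.Finite (MvPolynomial (Fin s) ℂ) B := hfin
  have : FaithfulSMul (MvPolynomial (Fin s) ℂ) B := (faithfulSMul_iff_algebraMap_injective _ _).2 hg
  have : IsNoetherianRing B := Algebra.FiniteType.isNoetherianRing ℂ B
  have hmc : (m.under (MvPolynomial (Fin s) ℂ)).IsMaximal := inferInstance
  refine le_antisymm Ideal.height_le_ringKrullDim_of_isPrime ?_
  have hle : ringKrullDim B ≤ s := by
    have : ringKrullDim B ≤ ringKrullDim (MvPolynomial (Fin s) ℂ) := by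
      refine Order.krullDim_le_of_strictMono
        (PrimeSpectrum.comap (algebraMap (MvPolynomial (Fin s) ℂ) B)) fun p q hpq => ?_
      exact Ideal.IsIntegral.comap_lt_comap hpq
    simpa [MvPolynomial.ringKrullDim_of_isNoetherianRing] using this
  refine hle.trans ?_
  obtain ⟨x, hx⟩ := isMaximal_iff_eq_vanishingIdeal_singleton.1 hmc
  have h := Ideal.height_eq_height_add_of_liesOver_of_hasGoingDown
    (m.under (MvPolynomial (Fin s) ℂ)) m
  rw [hx, height_vanishingIdeal_singleton] at h
  rw [h]
  exact_mod_cast le_self_add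

lemma Ideal.IsMaximal.map_quotientMk {B : Type*} [CommRing B] {I m : Ideal B} (hm : m.IsMaximal)
    (h : I ≤ m) : (m.map (Ideal.Quotient.mk I)).IsMaximal := by
  refine (Ideal.map_eq_top_or_isMaximal_of_surjective _ Ideal.Quotient.mk_surjective
    hm).resolve_left fun htop => hm.ne_top ?_
  rw [← Ideal.comap_map_mk h, htop, Ideal.comap_top]

/-- Some function vanishes on all the components of the zero set of `I` except that of `p`. -/
lemma Ideal.exists_mem_minimalPrimes_notMem {B : Type*} [CommRing B] [IsNoetherianRing B]
    (I p : Ideal B) (hp : p ∈ I.minimalPrimes) :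
    ∃ h ∉ p, ∀ q ∈ I.minimalPrimes, q ≠ p → h ∈ q := by
  classical
  have hfin := Ideal.finite_minimalPrimes_of_isNoetherianRing B I
  let s := hfin.toFinset.erase p
  have : ¬ s.inf id ≤ p := by
    rw [Ideal.IsPrime.inf_le' hp.isPrime]
    rintro ⟨q, hq, hqp⟩
    rw [Finset.mem_erase, Set.Finite.mem_toFinset] at hq
    exact hq.1 (le_antisymm hqp (hp.2 hq.2.1 hqp))
  obtain ⟨h, hs, hhp⟩ := SetLike.not_le_iff_exists.1 this
  refine ⟨h, hhp, fun q hq hqp => ?_⟩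
  exact (Finset.inf_le (f := id) (by simpa [s] using ⟨hqp, hq⟩ : q ∈ s)) hs

/-- In an affine domain, each component of the zero set of `r` elements has codimension at
most `r`. -/
lemma ringKrullDim_le_ringKrullDim_quotient_minimalPrime_add_card {B : Type} [CommRing B]
    [IsDomain B] [Algebra ℂ B] [Algebra.FiniteType ℂ B] (s : Finset B) (p : Ideal B)
    (hp : p ∈ (Ideal.span (s : Set B)).minimalPrimes) :
    ringKrullDim B ≤ ringKrullDim (B ⧸ p) + s.card := by
  classical
  have : IsNoetherianRing B := Algebra.FiniteType.isNoetherianRing ℂ B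
  have : IsJacobsonRing B := isJacobsonRing_of_finiteType (A := ℂ)
  have := hp.isPrime
  obtain ⟨h, hhp, hh⟩ := Ideal.exists_mem_minimalPrimes_notMem _ p hp
  -- the component of `p` is the only one through the closed point `m`
  obtain ⟨m, hpm, hm, hhm⟩ : ∃ m : Ideal B, p ≤ m ∧ m.IsMaximal ∧ h ∉ m := by
    by_contra! hcon
    have : h ∈ p.jacobson := by
      rw [Ideal.jacobson, Ideal.mem_sInf]
      exact fun J hJ => hcon J hJ.1 hJ.2
    rw [IsJacobsonRing.out ‹IsJacobsonRing B› hp.isPrime.isRadical] at this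
    exact hhp this
  let m' := m.map (Ideal.Quotient.mk p)
  have hcm : m'.comap (Ideal.Quotient.mk p) = m := Ideal.comap_map_mk hpm
  have hm' : m'.IsMaximal := hm.map_quotientMk hpm
  obtain ⟨t, hmt, ht⟩ := Ideal.exists_finset_card_eq_height_of_isNoetherianRing m'
  let σ := Function.surjInv (Ideal.Quotient.mk_surjective (I := p))
  have hσ : ∀ b, Ideal.Quotient.mk p (σ b) = b :=
    Function.surjInv_eq (Ideal.Quotient.mk_surjective (I := p))
  have hmin : m ∈ (Ideal.span ((s ∪ t.image σ : Finset B) : Set B)).minimalPrimes := by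
    refine ⟨⟨hm.isPrime, ?_⟩, fun q hq hqm => ?_⟩
    · rw [Ideal.span_le, Finset.coe_union, Finset.coe_image, Set.union_subset_iff]
      refine ⟨(Ideal.span_le.1 hp.le).trans hpm, ?_⟩
      rintro _ ⟨b, hb, rfl⟩
      change σ b ∈ m
      rw [← hcm, Ideal.mem_comap, hσ]
      exact hmt.le (Ideal.subset_span hb)
    · have := hq.1
      have hq2 := Ideal.span_le.1 hq.2
      rw [Finset.coe_union, Set.union_subset_iff] at hq2
      have hpq : p ≤ q := by
        obtain ⟨q', hq', hq'q⟩ := Ideal.exists_minimalPrimes_le (Ideal.span_le.2 hq2.1)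
        by_contra hne
        refine hhm (hqm (hq'q (hh q' hq' ?_)))
        rintro rfl
        exact hne hq'q
      have hcq : (q.map (Ideal.Quotient.mk p)).comap (Ideal.Quotient.mk p) = q :=
        Ideal.comap_map_mk hpq
      rw [← hcm, ← hcq]
      refine Ideal.comap_mono (hmt.2 ⟨Ideal.isPrime_map_quotientMk_of_isPrime hpq, ?_⟩
        (Ideal.map_mono hqm))
      rw [Ideal.span_le]
      intro b hb
      rw [← hσ b]
      exact Ideal.mem_map_of_mem _ (hq2.2 (by simpa using ⟨b, hb, rfl⟩))
  have hcard := Ideal.height_le_card_of_mem_minimalPrimes_span_finset hmin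
  rw [← hm.height_eq_ringKrullDim, ← hm'.height_eq_ringKrullDim, ← ht]
  have : (s ∪ t.image σ).card ≤ t.card + s.card :=
    (Finset.card_union_le _ _).trans (by have := Finset.card_image_le (s := t) (f := σ); omega)
  exact_mod_cast hcard.trans (by exact_mod_cast this)

/-! ### Tangent spaces and dimension -/

/-- The gradient at `x`, as a linear map on polynomials. -/
noncomputable def gradientMap {n : ℕ} (x : Fin n → ℂ) : MvPolynomial (Fin n) ℂ →ₗ[ℂ] (Fin n → ℂ) where
  toFun h := gradientAt h x
  map_add' p q := by ext j; simp [gradientAt]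
  map_smul' a p := by ext j; simp [gradientAt]

/-- The conormal space of `V` at `x`: the gradients at `x` of the polynomials that vanish
on `V`. -/
noncomputable def conormalSpaceAt {n : ℕ} (V : Set (Fin n → ℂ)) (x : Fin n → ℂ) : Submodule ℂ (Fin n → ℂ) :=
  ((vanishingIdeal ℂ V).restrictScalars ℂ).map (gradientMap x)

lemma gradientAt_mem_conormalSpaceAt {n : ℕ} {V : Set (Fin n → ℂ)} {x : Fin n → ℂ}
    {h : MvPolynomial (Fin n) ℂ} (hh : h ∈ vanishingIdeal ℂ V) :
    gradientAt h x ∈ conormalSpaceAt V x :=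
  ⟨h, hh, rfl⟩

lemma finrank_conormalSpaceAt_add_finrank_tangentSpaceAt {n : ℕ} (V : Set (Fin n → ℂ))
    (x : Fin n → ℂ) :
    Module.finrank ℂ (conormalSpaceAt V x) + Module.finrank ℂ (tangentSpaceAt V x) = n := by
  let e := dotProductEquiv ℂ (Fin n)
  have h := Subspace.finrank_add_finrank_dualCoannihilator_eq
    ((conormalSpaceAt V x).map (e : (Fin n → ℂ) →ₗ[ℂ] Module.Dual ℂ (Fin n → ℂ)))
  have hT : ((conormalSpaceAt V x).map
      (e : (Fin n → ℂ) →ₗ[ℂ] Module.Dual ℂ (Fin n → ℂ))).dualCoannihilator =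
      tangentSpaceAt V x := by
    ext v
    rw [Submodule.mem_dualCoannihilator]
    constructor
    · intro hv h hh
      exact hv _ ⟨_, gradientAt_mem_conormalSpaceAt hh, rfl⟩
    · rintro hv _ ⟨_, ⟨h, hh, rfl⟩, rfl⟩
      exact hv h hh
  rw [hT, LinearEquiv.finrank_map_eq e, Module.finrank_fin_fun] at h
  exact h

/-- First order Taylor expansion: modulo the square of the maximal ideal of `x`, a polynomial is
determined by its value and its gradient at `x`. -/
lemma sub_taylor_mem_sq {n : ℕ} (x : Fin n → ℂ) (h : MvPolynomial (Fin n) ℂ) :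
    h - C (aeval x h) - ∑ k, C (gradientAt h x k) * (X k - C (x k)) ∈
      (vanishingIdeal ℂ {x} : Ideal (MvPolynomial (Fin n) ℂ)) ^ 2 := by
  have hX (k : Fin n) : X k - C (x k) ∈ (vanishingIdeal ℂ {x} : Ideal (MvPolynomial (Fin n) ℂ)) := by
    rw [mem_vanishingIdeal_singleton_iff]
    simp
  induction h using MvPolynomial.induction_on with
  | C a => simp [gradientAt]
  | add p q hp hq =>
    convert! Ideal.add_mem _ hp hq using 1
    simp only [gradientAt, map_add, add_mul, Finset.sum_add_distrib]
    ring
  | mul_X p j hp =>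
    have hg (k : Fin n) : gradientAt (p * X j) x k =
        gradientAt p x k * x j + if k = j then aeval x p else 0 := by
      by_cases hk : k = j
      · subst hk; simp [gradientAt, Derivation.leibniz]; ring
      · simp [gradientAt, Derivation.leibniz, pderiv_X_of_ne (Ne.symm hk), hk]; ring
    have h2 : (X j - C (x j)) * ∑ k, C (gradientAt p x k) * (X k - C (x k)) ∈
        (vanishingIdeal ℂ {x} : Ideal (MvPolynomial (Fin n) ℂ)) ^ 2 := by
      rw [sq]
      exact Ideal.mul_mem_mul (hX j) (Ideal.sum_mem _ fun k _ => Ideal.mul_mem_left _ _ (hX k))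
    convert! Ideal.add_mem _ (Ideal.mul_mem_left _ (X j) hp) h2 using 1
    have : ∑ k, C (gradientAt (p * X j) x k) * (X k - C (x k)) =
        C (x j) * (∑ k, C (gradientAt p x k) * (X k - C (x k))) +
          C (aeval x p) * (X j - C (x j)) := by
      simp only [hg, C_add, C_mul, add_mul, Finset.sum_add_distrib, Finset.mul_sum]
      congr 1
      · exact Finset.sum_congr rfl fun k _ => by ring
      · rw [Finset.sum_eq_single j] <;> simp +contextual
    rw [this, map_mul, aeval_X, C_mul]
    ring

/-- The tangent space at a point of an irreducible set has at least the dimension of the set: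
together with the equations of the set, as many linear forms as the dimension of the tangent
space generate the maximal ideal of the point locally. -/
lemma algDim_le_finrank_tangentSpaceAt {n : ℕ} {V : Set (Fin n → ℂ)}
    (hV : (vanishingIdeal ℂ V).IsPrime) {x : Fin n → ℂ} (hx : x ∈ V) :
    algDim V ≤ Module.finrank ℂ (tangentSpaceAt V x) := by
  classical
  set P := vanishingIdeal ℂ V with hP
  set M : Ideal (MvPolynomial (Fin n) ℂ) := vanishingIdeal ℂ {x} with hM
  have hMmax : M.IsMaximal := isMaximal_iff_eq_vanishingIdeal_singleton.2 ⟨x, rfl⟩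
  have hPM : P ≤ M := vanishingIdeal_anti_mono (Set.singleton_subset_iff.2 hx)
  obtain ⟨N, hN⟩ := Submodule.exists_isCompl (conormalSpaceAt V x)
  have hNfin : Module.finrank ℂ N = Module.finrank ℂ (tangentSpaceAt V x) := by
    have h1 := Submodule.finrank_add_eq_of_isCompl hN
    have h2 := finrank_conormalSpaceAt_add_finrank_tangentSpaceAt V x
    rw [Module.finrank_fin_fun] at h1
    omega
  let b := Module.finBasis ℂ N
  let l (v : Fin n → ℂ) : MvPolynomial (Fin n) ℂ := ∑ k, C (v k) * (X k - C (x k))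
  have hlM (v : Fin n → ℂ) : l v ∈ M := by
    rw [mem_vanishingIdeal_singleton_iff]
    simp [l]
  let lin : (Fin n → ℂ) →ₗ[ℂ] MvPolynomial (Fin n) ℂ :=
    { toFun := l
      map_add' := fun v w => by simp [l, add_mul, Finset.sum_add_distrib]
      map_smul' := fun a v => by simp [l, MvPolynomial.smul_eq_C_mul, Finset.mul_sum, mul_assoc] }
  let t : Finset (MvPolynomial (Fin n) ℂ) := Finset.univ.image fun a => l (b a)
  have hJ : M ≤ (P ⊔ Ideal.span (t : Set (MvPolynomial (Fin n) ℂ))) ⊔ M • M := by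
    intro h hh
    have hgrad : gradientAt h x ∈ conormalSpaceAt V x ⊔ N := by
      rw [hN.sup_eq_top]; trivial
    obtain ⟨_, ⟨p, hp, rfl⟩, w, hw, hpw⟩ := Submodule.mem_sup.1 hgrad
    have hp' : p ∈ P := hp
    have h1 := sub_taylor_mem_sq x h
    have h2 := sub_taylor_mem_sq x p
    rw [(mem_vanishingIdeal_singleton_iff x h).1 hh] at h1
    rw [(mem_vanishingIdeal_singleton_iff x p).1 (hPM hp')] at h2
    have hlw : l w ∈ Ideal.span (t : Set (MvPolynomial (Fin n) ℂ)) := by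
      have hsum : w = ∑ a, b.repr ⟨w, hw⟩ a • (b a : Fin n → ℂ) := by
        conv_lhs => rw [show w = ((⟨w, hw⟩ : N) : Fin n → ℂ) from rfl, ← b.sum_repr ⟨w, hw⟩]
        rw [Submodule.coe_sum]
        rfl
      have : l w = ∑ a, b.repr ⟨w, hw⟩ a • l (b a) := by
        change lin w = ∑ a, b.repr ⟨w, hw⟩ a • lin (b a)
        conv_lhs => rw [hsum]
        simp
      rw [this]
      refine Ideal.sum_mem _ fun a _ => ?_
      rw [MvPolynomial.smul_eq_C_mul]
      exact Ideal.mul_mem_left _ _ (Ideal.subset_span (by simp [t]))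
    have heq : h = (p + l w) + ((h - C 0 - l (gradientAt h x)) - (p - C 0 - l (gradientAt p x))) := by
      have : l (gradientAt h x) = l (gradientAt p x) + l w := by
        rw [← hpw]
        exact lin.map_add _ _
      rw [this]
      ring
    rw [heq]
    refine Submodule.add_mem_sup (Submodule.add_mem_sup hp' hlw) ?_
    rw [smul_eq_mul, ← sq]
    exact Ideal.sub_mem _ h1 h2
  obtain ⟨r, hr1, hr2⟩ := Submodule.exists_sub_one_mem_and_smul_le_of_fg_of_le_sup
    (IsNoetherian.noetherian M) le_rfl hJ
  have hrM : r ∉ M := fun hr => hMmax.ne_top ((Ideal.eq_top_iff_one _).2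
    (by simpa using Ideal.sub_mem _ hr hr1))
  let φ := Ideal.Quotient.mk P
  have hcm : (M.map φ).comap φ = M := Ideal.comap_map_mk hPM
  have hM' : (M.map φ).IsMaximal := hMmax.map_quotientMk hPM
  have hmin : M.map φ ∈ (Ideal.span ((t.image φ : Finset _) : Set (_ ⧸ P))).minimalPrimes := by
    refine ⟨⟨hM'.isPrime, ?_⟩, fun q hq hqM => ?_⟩
    · rw [Ideal.span_le, Finset.coe_image]
      rintro _ ⟨y, hy, rfl⟩
      obtain ⟨a, -, rfl⟩ := Finset.mem_image.1 hy
      exact Ideal.mem_map_of_mem _ (hlM _)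
    · have hqp := hq.1
      have hPq : P ≤ q.comap φ := fun y hy => by
        rw [Ideal.mem_comap, Ideal.Quotient.eq_zero_iff_mem.2 hy]
        exact q.zero_mem
      have htq : Ideal.span (t : Set (MvPolynomial (Fin n) ℂ)) ≤ q.comap φ := by
        rw [Ideal.span_le]
        intro y hy
        exact hq.2 (Ideal.subset_span (by simpa using ⟨y, hy, rfl⟩))
      have hrq : r ∉ q.comap φ := fun hr => hrM (by
        rw [← hcm]
        exact Ideal.comap_mono hqM hr)
      rw [Ideal.map_le_iff_le_comap]
      intro y hy
      have : r * y ∈ q.comap φ := sup_le hPq htq (hr2 (Submodule.smul_mem_pointwise_smul y r M hy))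
      exact ((Ideal.IsPrime.comap φ).mem_or_mem this).resolve_left hrq
  have hcard := Ideal.height_le_card_of_mem_minimalPrimes_span_finset hmin
  have hcard2 : (t.image φ).card ≤ Module.finrank ℂ (tangentSpaceAt V x) := by
    rw [← hNfin]
    refine Finset.card_image_le.trans (Finset.card_image_le.trans ?_)
    simp
  rw [algDim, ← hP, ← hM'.height_eq_ringKrullDim]
  exact_mod_cast hcard.trans (by exact_mod_cast hcard2)

section Limit

open Filter Topology

/-! ### Isolating a zero of a function on an irreducible variety -/

/-- For a function `f` that vanishes at a point `M` of `V(Q)` but not on all of `V(Q)`, there is an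
irreducible closed subset `V(q)` of `V(Q)` through `M` in which `M` is a component of the zero set of
`f`. A prime `q` maximal among those below `M` that do not contain `f` works: otherwise prime
avoidance gives a function `g` whose zero set in `V(q)` has a component through `M` that lies properly
inside a component of the zero set of `f`, so that its codimension is more than one. -/
lemma Ideal.exists_isPrime_mem_minimalPrimes_sup_span_singleton {R : Type*} [CommRing R]
    [IsNoetherianRing R] {Q M : Ideal R} [hQ : Q.IsPrime] [hM : M.IsPrime] (hQM : Q ≤ M) {f : R}
    (hfM : f ∈ M) (hfQ : f ∉ Q) :
    ∃ q : Ideal R, q.IsPrime ∧ Q ≤ q ∧ q ≤ M ∧ f ∉ q ∧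
      M ∈ (q ⊔ Ideal.span {f}).minimalPrimes := by
  classical
  obtain ⟨q, ⟨hq, hQq, hqM, hfq⟩, hmax⟩ := set_has_maximal_iff_noetherian.2 ‹IsNoetherianRing R›
    {q : Ideal R | q.IsPrime ∧ Q ≤ q ∧ q ≤ M ∧ f ∉ q} ⟨Q, hQ, le_rfl, hQM, hfQ⟩
  refine ⟨q, hq, hQq, hqM, hfq, ?_⟩
  set I : Ideal R := q ⊔ Ideal.span {f} with hI
  have hle : I ≤ M := sup_le hqM ((Ideal.span_singleton_le_iff_mem _).2 hfM)
  have hfin := Ideal.finite_minimalPrimes_of_isNoetherianRing R I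
  by_cases hcover : (M : Set R) ⊆ ⋃ p ∈ (hfin.toFinset : Set (Ideal R)), (p : Set R)
  · obtain ⟨p, hp, hMp⟩ := (Ideal.subset_union_prime (f := fun p : Ideal R => p) ⊤ ⊤
      fun p hp _ _ => (hfin.mem_toFinset.1 hp).isPrime).1 hcover
    rw [hfin.mem_toFinset] at hp
    rwa [le_antisymm hMp (hp.2 ⟨hM, hle⟩ hMp)]
  · exfalso
    obtain ⟨g, hgM, hg⟩ := Set.not_subset.1 hcover
    have hg' : ∀ p ∈ I.minimalPrimes, g ∉ p := fun p hp hgp =>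
      hg (Set.mem_biUnion (by simpa using hp) hgp)
    obtain ⟨p', hp', hp'M⟩ := Ideal.exists_minimalPrimes_le hle
    obtain ⟨P, hP, hPM⟩ := Ideal.exists_minimalPrimes_le
      (sup_le hqM ((Ideal.span_singleton_le_iff_mem _).2 hgM) : q ⊔ Ideal.span {g} ≤ M)
    have := hP.isPrime
    have hqP : q ≤ P := le_sup_left.trans hP.le
    have hgP : g ∈ P := hP.le (Ideal.mem_sup_right (Ideal.mem_span_singleton_self g))
    have hfP : f ∈ P := by
      by_contra hfP
      have hqP' : q = P := eq_of_le_of_not_lt hqP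
        (hmax P ⟨hP.isPrime, hQq.trans hqP, hPM, hfP⟩)
      refine hg' p' hp' (hp'.le (Ideal.mem_sup_left ?_))
      rwa [hqP']
    obtain ⟨p, hp, hpP⟩ := Ideal.exists_minimalPrimes_le
      (sup_le hqP ((Ideal.span_singleton_le_iff_mem _).2 hfP) : I ≤ P)
    have := hp.isPrime
    have hqp : q ≤ p := le_sup_left.trans hp.le
    have hfp : f ∈ p := hp.le (Ideal.mem_sup_right (Ideal.mem_span_singleton_self f))
    have hpP' : p < P := lt_of_le_of_ne hpP fun h => hg' p hp (h ▸ hgP)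
    have hheight : (P.map (Ideal.Quotient.mk q)).height ≤ ((1 : ℕ) : ℕ∞) :=
      Ideal.map_height_le_one_of_mem_minimalPrimes hP
    have := Ideal.isPrime_map_quotientMk_of_isPrime hqP
    have hpp := Ideal.isPrime_map_quotientMk_of_isPrime hqp
    have hlt : p.map (Ideal.Quotient.mk q) < P.map (Ideal.Quotient.mk q) := by
      refine lt_of_le_of_ne (Ideal.map_mono hpP) fun h => hpP'.ne ?_
      rw [← Ideal.comap_map_mk hqp, h, Ideal.comap_map_mk hqP]
    have h0 : (p.map (Ideal.Quotient.mk q)).height = 0 := by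
      have := Ideal.height_le_iff.1 hheight _ hpp hlt
      exact Order.lt_one_iff.1 (by simpa using this)
    have : IsDomain (R ⧸ q) := Ideal.Quotient.isDomain q
    rw [Ideal.height_eq_zero_iff_eq_bot] at h0
    have hmem : Ideal.Quotient.mk q f ∈ p.map (Ideal.Quotient.mk q) := Ideal.mem_map_of_mem _ hfp
    rw [h0, Ideal.mem_bot, Ideal.Quotient.eq_zero_iff_mem] at hmem
    exact hfq hmem

/-! ### Continuity of roots -/

/-- Continuity of a root: a zero of the entire function `Φ 0`, which does not vanish identically,
persists under a small change of the parameter. -/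
lemma eventually_exists_root_of_continuous {Φ : ℂ → ℂ → ℂ}
    (hc : Continuous fun q : ℂ × ℂ => Φ q.1 q.2) (hd : ∀ w, Differentiable ℂ (Φ w))
    (h0 : Φ 0 0 = 0) (h1 : ∃ s, Φ 0 s ≠ 0) {ε : ℝ} (hε : 0 < ε) :
    ∀ᶠ w in 𝓝 (0 : ℂ), ∃ s, ‖s‖ < ε ∧ Φ w s = 0 := by
  have han : AnalyticOnNhd ℂ (Φ 0) Set.univ := (hd 0).differentiableOn.analyticOnNhd isOpen_univ
  have hne : ∀ᶠ s in 𝓝[≠] (0 : ℂ), Φ 0 s ≠ 0 := by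
    refine (han 0 trivial).eventually_eq_zero_or_eventually_ne_zero.resolve_left fun h => ?_
    obtain ⟨s, hs⟩ := h1
    exact hs (han.eqOn_zero_of_preconnected_of_eventuallyEq_zero isPreconnected_univ trivial h trivial)
  obtain ⟨δ, hδ, hδne⟩ := Metric.eventually_nhds_iff.1 (eventually_nhdsWithin_iff.1 hne)
  let r := min (ε / 2) (δ / 2)
  have hr : 0 < r := by positivity
  have hrε : r < ε := (min_le_left _ _).trans_lt (half_lt_self hε)
  have hrδ : r < δ := (min_le_right _ _).trans_lt (half_lt_self hδ)
  have hsph : ∀ s ∈ Metric.sphere (0 : ℂ) r, Φ 0 s ≠ 0 := fun s hs => by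
    refine hδne ((Metric.mem_sphere.1 hs).trans_lt hrδ) ?_
    rintro rfl
    simp at hs
    exact hr.ne hs
  obtain ⟨s₀, hs₀, hmin⟩ := (isCompact_sphere (0 : ℂ) r).exists_isMinOn
    (NormedSpace.sphere_nonempty.2 hr.le) ((hd 0).continuous.norm.continuousOn)
  have hm : 0 < ‖Φ 0 s₀‖ := norm_pos_iff.2 (hsph s₀ hs₀)
  set m := ‖Φ 0 s₀‖
  have hcw (s : ℂ) : Continuous fun w => Φ w s := hc.comp (by fun_prop : Continuous fun w => (w, s))
  have hev1 : ∀ᶠ w in 𝓝 (0 : ℂ), ‖Φ w 0‖ < m / 4 := by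
    refine (hcw 0).norm.continuousAt.eventually_lt continuousAt_const ?_
    simp only [h0, norm_zero]
    positivity
  have hev2 : ∀ᶠ w in 𝓝 (0 : ℂ), ∀ s ∈ Metric.sphere (0 : ℂ) r, m / 2 < ‖Φ w s - Φ w 0‖ := by
    refine (isCompact_sphere (0 : ℂ) r).eventually_forall_of_forall_eventually fun s hs => ?_
    have hcont : Continuous fun q : ℂ × ℂ => ‖Φ q.1 q.2 - Φ q.1 0‖ :=
      (hc.sub (hc.comp (by fun_prop : Continuous fun q : ℂ × ℂ => (q.1, (0 : ℂ))))).norm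
    refine continuousAt_const.eventually_lt hcont.continuousAt ?_
    simp only [h0, sub_zero]
    have : m ≤ ‖Φ 0 s‖ := hmin hs
    linarith
  -- on the circle of radius `r`, `Φ w` stays away from `Φ w 0`, so that the image of the disc contains
  -- a disc around `Φ w 0`, and this disc contains `0`
  filter_upwards [hev1, hev2] with w hw1 hw2
  have hfreq : ∃ᶠ s in 𝓝 (0 : ℂ), Φ w s ≠ Φ w 0 := by
    intro hcon
    simp only [not_not] at hcon
    have han' : AnalyticOnNhd ℂ (fun s => Φ w s - Φ w 0) Set.univ :=
      ((hd w).sub_const _).differentiableOn.analyticOnNhd isOpen_univ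
    have := han'.eqOn_zero_of_preconnected_of_eventuallyEq_zero isPreconnected_univ
      (Set.mem_univ 0) (hcon.mono fun s hs => by simp [hs]) (Set.mem_univ s₀)
    have h2 := hw2 s₀ hs₀
    simp only [Pi.zero_apply] at this
    rw [this, norm_zero] at h2
    linarith
  obtain ⟨s, hs, hs0⟩ := (hd w).diffContOnCl.ball_subset_image_closedBall hr
    (fun s hs => (hw2 s hs).le) hfreq (show (0 : ℂ) ∈ _ by
      rw [Metric.mem_ball, dist_eq_norm, zero_sub, norm_neg]; linarith)
  exact ⟨s, (mem_closedBall_zero_iff.1 hs).trans_lt hrε, hs0⟩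

/-! ### Complex points of integral extensions -/

/-- Over an algebraically closed field, the residue field of a closed point of an affine scheme is
the ground field. -/
lemma Ideal.IsMaximal.exists_algHom_ker_eq {B : Type*} [CommRing B] [Algebra ℂ B]
    [Algebra.FiniteType ℂ B] (m : Ideal B) [hm : m.IsMaximal] :
    ∃ φ : B →ₐ[ℂ] ℂ, RingHom.ker φ = m := by
  let := Ideal.Quotient.field m
  have : Module.Finite ℂ (B ⧸ m) := finite_of_finite_type_of_isJacobsonRing ℂ (B ⧸ m)
  let e := AlgEquiv.ofBijective (Algebra.ofId ℂ (B ⧸ m))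
    IsAlgClosed.algebraMap_bijective_of_isIntegral
  refine ⟨(e.symm : (B ⧸ m) →ₐ[ℂ] ℂ).comp (Ideal.Quotient.mkₐ ℂ m), ?_⟩
  ext b
  simp [RingHom.mem_ker, Ideal.Quotient.eq_zero_iff_mem]

/-- Let `B` be an integral extension of the normal domain `A`. A complex point of `A`, together with
a root of the specialized minimal polynomial of `F ∈ B`, is induced by a complex point of `B`. -/
lemma exists_algHom_of_aeval_minpoly_eq_zero {A B : Type*} [CommRing A] [IsDomain A]
    [IsIntegrallyClosed A] [CommRing B] [IsDomain B] [Algebra A B] [Module.IsTorsionFree A B]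
    [Algebra.IsIntegral A B] [Algebra ℂ A] [Algebra ℂ B] [IsScalarTower ℂ A B]
    [Algebra.FiniteType ℂ B] (u : A →ₐ[ℂ] ℂ) (F : B) (w : ℂ)
    (hw : (minpoly A F).eval₂ u.toRingHom w = 0) :
    ∃ φ : B →ₐ[ℂ] ℂ, φ F = w ∧ ∀ a, φ (algebraMap A B a) = u a := by
  let θ : Polynomial A →+* ℂ := Polynomial.eval₂RingHom u.toRingHom w
  have hθsurj : Function.Surjective θ := fun c => ⟨Polynomial.C (algebraMap ℂ A c), by simp [θ]⟩
  have hmax : (RingHom.ker θ).IsMaximal := RingHom.ker_isMaximal_of_surjective θ hθsurj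
  let := (Polynomial.aeval (R := A) F).toRingHom.toAlgebra
  have halg (p : Polynomial A) : algebraMap (Polynomial A) B p = Polynomial.aeval F p := rfl
  have : IsScalarTower A (Polynomial A) B := IsScalarTower.of_algebraMap_eq fun a => by
    rw [halg]; simp
  have : Algebra.IsIntegral (Polynomial A) B := Algebra.IsIntegral.tower_top A
  have hker : RingHom.ker (algebraMap (Polynomial A) B) ≤ RingHom.ker θ := by
    intro p hp
    rw [RingHom.mem_ker, halg] at hp
    obtain ⟨q, rfl⟩ := minpoly.isIntegrallyClosed_dvd (Algebra.IsIntegral.isIntegral F) hp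
    rw [RingHom.mem_ker, map_mul, show θ (minpoly A F) = 0 from hw, zero_mul]
  obtain ⟨m, hm, hmc⟩ := Ideal.exists_ideal_over_maximal_of_isIntegral _ hker
  obtain ⟨φ, hφ⟩ := hm.exists_algHom_ker_eq
  have key (p : Polynomial A) : φ (Polynomial.aeval F p) = θ p := by
    have h1 : p - Polynomial.C (algebraMap ℂ A (θ p)) ∈ RingHom.ker θ := by
      simp [RingHom.mem_ker, θ]
    rw [← hmc, Ideal.mem_comap, ← hφ, RingHom.mem_ker, halg, map_sub, map_sub, sub_eq_zero] at h1
    rw [h1, Polynomial.aeval_C, ← IsScalarTower.algebraMap_apply ℂ A B]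
    simp
  refine ⟨φ, ?_, fun a => ?_⟩
  · simpa [θ] using key Polynomial.X
  · simpa [θ] using key (Polynomial.C a)

lemma minpoly.coeff_zero_ne_zero_of_isIntegrallyClosed {A B : Type*} [CommRing A] [IsDomain A]
    [IsIntegrallyClosed A] [CommRing B] [IsDomain B] [Algebra A B] [Module.IsTorsionFree A B]
    {F : B} (hint : IsIntegral A F) (hF : F ≠ 0) : (minpoly A F).coeff 0 ≠ 0 := by
  intro h
  obtain ⟨q, hq⟩ := Polynomial.X_dvd_iff.2 h
  have hq0 : Polynomial.aeval F q = 0 := by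
    have := minpoly.aeval A F
    rw [hq, map_mul, Polynomial.aeval_X] at this
    exact (mul_eq_zero.1 this).resolve_left hF
  have hqne : q ≠ 0 := by
    rintro rfl
    exact minpoly.ne_zero hint (by simpa using hq)
  have := Polynomial.natDegree_le_of_dvd (minpoly.isIntegrallyClosed_dvd hint hq0) hqne
  rw [hq, Polynomial.natDegree_X_mul hqne] at this
  omega

lemma Polynomial.Monic.norm_root_le {p : Polynomial ℂ} (hp : p.Monic) {z : ℂ} (hz : p.IsRoot z) :
    ‖z‖ ≤ ∑ i ∈ Finset.range p.natDegree, ‖p.coeff i‖ + 1 := by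
  have h := (hz.norm_lt_cauchyBound hp.ne_zero).le
  have h2 : p.cauchyBound ≤ ∑ i ∈ Finset.range p.natDegree, ‖p.coeff i‖₊ + 1 := by
    rw [Polynomial.cauchyBound, hp.leadingCoeff, nnnorm_one, div_one]
    gcongr
    exact Finset.sup_le fun i hi =>
      Finset.single_le_sum (f := fun i => ‖p.coeff i‖₊) (fun _ _ => zero_le) hi
  simpa using NNReal.coe_le_coe.2 (h.trans h2)

section Integral

variable {s : ℕ} {B : Type*} [CommRing B] [Algebra ℂ B] [Algebra (MvPolynomial (Fin s) ℂ) B]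
  [IsScalarTower ℂ (MvPolynomial (Fin s) ℂ) B]

lemma algHom_algebraMap_eq_aeval (φ : B →ₐ[ℂ] ℂ) (a : MvPolynomial (Fin s) ℂ) :
    φ (algebraMap _ B a) = aeval (fun j => φ (algebraMap (MvPolynomial (Fin s) ℂ) B (X j))) a := by
  have : φ.comp (IsScalarTower.toAlgHom ℂ (MvPolynomial (Fin s) ℂ) B) =
      aeval (fun j => φ (algebraMap (MvPolynomial (Fin s) ℂ) B (X j))) := by
    ext1 j
    simp
  exact DFunLike.congr_fun this a

/-- A finite map to affine space is proper: if `φ₀` is the only zero of `F`, then the points whose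
image is close to that of `φ₀`, and at which `F` is small, are close to `φ₀`. Every limit of such
points along an ultrafilter exists, because the functions in `B` stay bounded, and is a zero
of `F`. -/
lemma tendsto_algHom_apply_of_isIntegral [Algebra.IsIntegral (MvPolynomial (Fin s) ℂ) B] (F : B)
    (φ₀ : B →ₐ[ℂ] ℂ) (hφ₀ : ∀ φ : B →ₐ[ℂ] ℂ, φ F = 0 → φ = φ₀) (b : B) :
    Tendsto (fun φ : B →ₐ[ℂ] ℂ => φ b)
      (comap (fun φ : B →ₐ[ℂ] ℂ =>
        ((fun j => φ (algebraMap (MvPolynomial (Fin s) ℂ) B (X j))), φ F))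
        (𝓝 ((fun j => φ₀ (algebraMap (MvPolynomial (Fin s) ℂ) B (X j))), 0)))
      (𝓝 (φ₀ b)) := by
  rw [tendsto_iff_ultrafilter]
  intro 𝒰 h𝒰
  have hlim : Tendsto (fun φ : B →ₐ[ℂ] ℂ =>
      ((fun j => φ (algebraMap (MvPolynomial (Fin s) ℂ) B (X j))), φ F)) 𝒰
      (𝓝 ((fun j => φ₀ (algebraMap (MvPolynomial (Fin s) ℂ) B (X j))), 0)) :=
    tendsto_comap.mono_left h𝒰
  have hA (a : MvPolynomial (Fin s) ℂ) :
      Tendsto (fun φ : B →ₐ[ℂ] ℂ => φ (algebraMap _ B a)) 𝒰 (𝓝 (φ₀ (algebraMap _ B a))) := by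
    simp only [algHom_algebraMap_eq_aeval _ a]
    have hcont : Continuous fun u : Fin s → ℂ => aeval u a := by
      simpa [aeval_eq_eval] using MvPolynomial.continuous_eval a
    exact (hcont.tendsto _).comp ((continuous_fst.tendsto _).comp hlim)
  have hex (b : B) : ∃ c : ℂ, Tendsto (fun φ : B →ₐ[ℂ] ℂ => φ b) 𝒰 (𝓝 c) := by
    obtain ⟨p, hp, hpb⟩ := Algebra.IsIntegral.isIntegral (R := MvPolynomial (Fin s) ℂ) b
    have hbound (φ : B →ₐ[ℂ] ℂ) : ‖φ b‖ ≤
        ∑ i ∈ Finset.range p.natDegree, ‖φ (algebraMap _ B (p.coeff i))‖ + 1 := by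
      let g := φ.toRingHom.comp (algebraMap (MvPolynomial (Fin s) ℂ) B)
      have hroot : (p.map g).IsRoot (φ b) := by
        rw [Polynomial.IsRoot, Polynomial.eval_map]
        have := congrArg φ hpb
        rw [map_zero] at this
        rw [← this]
        exact (Polynomial.hom_eval₂ p _ φ.toRingHom b).symm
      have := (hp.map g).norm_root_le hroot
      rw [hp.natDegree_map g] at this
      simpa [g] using this
    have hsum : Tendsto (fun φ : B →ₐ[ℂ] ℂ =>
        ∑ i ∈ Finset.range p.natDegree, ‖φ (algebraMap _ B (p.coeff i))‖ + 1) 𝒰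
        (𝓝 (∑ i ∈ Finset.range p.natDegree, ‖φ₀ (algebraMap _ B (p.coeff i))‖ + 1)) :=
      (tendsto_finsetSum _ fun i _ => (hA _).norm).add_const 1
    have hev := hsum.eventually_lt_const (lt_add_one _)
    obtain ⟨c, -, hc⟩ := (isCompact_closedBall (0 : ℂ) _).ultrafilter_le_nhds
      (𝒰.map fun φ : B →ₐ[ℂ] ℂ => φ b) (le_principal_iff.2 (by
        rw [Ultrafilter.coe_map, mem_map]
        filter_upwards [hev] with φ hφ
        exact mem_closedBall_zero_iff.2 ((hbound φ).trans hφ.le)))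
    exact ⟨c, hc⟩
  choose c hc using hex
  let φ₁ : B →ₐ[ℂ] ℂ :=
    { toFun := c
      map_one' := tendsto_nhds_unique (hc 1) (by simp)
      map_zero' := tendsto_nhds_unique (hc 0) (by simp)
      map_mul' := fun x y => tendsto_nhds_unique (hc _) (by simpa using (hc x).mul (hc y))
      map_add' := fun x y => tendsto_nhds_unique (hc _) (by simpa using (hc x).add (hc y))
      commutes' := fun a => tendsto_nhds_unique (hc _) (by simp) }
  have h1 : φ₁ = φ₀ := hφ₀ φ₁
    (tendsto_nhds_unique (hc F) ((continuous_snd.tendsto _).comp hlim))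
  rw [← h1]
  exact hc b

end Integral

/-! ### Openness of polynomial functions on irreducible algebraic sets -/

/-- Openness of a function at an isolated zero, in terms of complex points: if `φ₀` is the only zero
of `F ≠ 0`, then `F` takes every small value at a point where the functions `b k` are close to their
values at `φ₀`. In a Noether normalization, for small `w` there is a point near the image of
`φ₀` at which `w` is a root of the minimal polynomial of `F`; by properness, a point above it at which
`F = w` is close to `φ₀`. -/
lemma eventually_exists_algHom_apply_eq {B : Type*} [CommRing B] [IsDomain B] [Algebra ℂ B]
    [Algebra.FiniteType ℂ B] (F : B) (hF : F ≠ 0) (φ₀ : B →ₐ[ℂ] ℂ) (hF₀ : φ₀ F = 0)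
    (hφ₀ : ∀ φ : B →ₐ[ℂ] ℂ, φ F = 0 → φ = φ₀) {ι : Type*} [Finite ι] (b : ι → B)
    {U : Set (ι → ℂ)} (hU : U ∈ 𝓝 fun k => φ₀ (b k)) :
    ∀ᶠ w in 𝓝 (0 : ℂ), ∃ φ : B →ₐ[ℂ] ℂ, φ F = w ∧ (fun k => φ (b k)) ∈ U := by
  obtain ⟨s, g, hg, hfin⟩ := exists_finite_inj_algHom_of_fg ℂ B
  let := g.toRingHom.toAlgebra
  have halg (a : MvPolynomial (Fin s) ℂ) : algebraMap (MvPolynomial (Fin s) ℂ) B a = g a := rfl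
  have : IsScalarTower ℂ (MvPolynomial (Fin s) ℂ) B := IsScalarTower.of_algebraMap_eq fun a => by
    rw [halg, AlgHom.map_algebraMap]
  have : Module.Finite (MvPolynomial (Fin s) ℂ) B := hfin
  have : FaithfulSMul (MvPolynomial (Fin s) ℂ) B := (faithfulSMul_iff_algebraMap_injective _ _).2 hg
  let P := minpoly (MvPolynomial (Fin s) ℂ) F
  let u₀ : Fin s → ℂ := fun j => φ₀ (algebraMap (MvPolynomial (Fin s) ℂ) B (X j))
  have hP0 : P.coeff 0 ≠ 0 :=
    minpoly.coeff_zero_ne_zero_of_isIntegrallyClosed (Algebra.IsIntegral.isIntegral F) hF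
  obtain ⟨v, hv⟩ : ∃ v : Fin s → ℂ, eval v (P.coeff 0) ≠ 0 := by
    by_contra! hcon
    exact hP0 (MvPolynomial.funext fun v => by simpa using hcon v)
  -- the value at `w` of the minimal polynomial of `F`, along the line through `u₀` and `v`
  let L (t : ℂ) : Fin s → ℂ := fun j => u₀ j + t * (v j - u₀ j)
  let Φ (w t : ℂ) : ℂ := P.eval₂ (aeval (L t) : MvPolynomial (Fin s) ℂ →ₐ[ℂ] ℂ).toRingHom w
  have hΦ (w t : ℂ) : Φ w t = ∑ i ∈ Finset.range (P.natDegree + 1), eval (L t) (P.coeff i) * w ^ i := by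
    simp only [Φ, Polynomial.eval₂_eq_sum_range]
    rfl
  have hLc : Continuous L := by fun_prop
  have hev (a : MvPolynomial (Fin s) ℂ) : Differentiable ℂ fun t => eval (L t) a := by
    induction a using MvPolynomial.induction_on with
    | C a => simp
    | add p q hp hq =>
      simp only [map_add]
      exact hp.fun_add hq
    | mul_X p j hp =>
      simp only [map_mul, eval_X]
      exact hp.mul (by fun_prop)
  have hL0 : L 0 = u₀ := by ext j; simp [L]
  have hL1 : L 1 = v := by ext j; simp [L]
  have hΦ00 : Φ 0 0 = 0 := by
    have h := congrArg φ₀ (minpoly.aeval (MvPolynomial (Fin s) ℂ) F)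
    rw [map_zero, Polynomial.aeval_def, ← AlgHom.coe_toRingHom, Polynomial.hom_eval₂] at h
    have hu₀ : (aeval u₀ : MvPolynomial (Fin s) ℂ →ₐ[ℂ] ℂ).toRingHom =
        (φ₀ : B →+* ℂ).comp (algebraMap (MvPolynomial (Fin s) ℂ) B) :=
      RingHom.ext fun a => (algHom_algebraMap_eq_aeval φ₀ a).symm
    rw [AlgHom.coe_toRingHom, hF₀] at h
    change Polynomial.eval₂ (aeval (L 0) : MvPolynomial (Fin s) ℂ →ₐ[ℂ] ℂ).toRingHom 0 P = 0
    rw [hL0, hu₀]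
    exact h
  have hProper : {φ : B →ₐ[ℂ] ℂ | (fun k => φ (b k)) ∈ U} ∈
      comap (fun φ : B →ₐ[ℂ] ℂ =>
        ((fun j => φ (algebraMap (MvPolynomial (Fin s) ℂ) B (X j))), φ F)) (𝓝 (u₀, 0)) :=
    (tendsto_pi_nhds.2 fun k => tendsto_algHom_apply_of_isIntegral F φ₀ hφ₀ (b k)) hU
  obtain ⟨W, hW, hWU⟩ := mem_comap.1 hProper
  have hLcont : Tendsto (fun q : ℂ × ℂ => (L q.1, q.2)) (𝓝 (0, 0)) (𝓝 (u₀, 0)) := by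
    have : Continuous fun q : ℂ × ℂ => (L q.1, q.2) := by fun_prop
    simpa [hL0] using this.tendsto (0, 0)
  have hmem := hLcont hW
  rw [mem_map, nhds_prod_eq, Metric.nhds_basis_ball.prod_self.mem_iff] at hmem
  obtain ⟨ε, hε, hsub⟩ := hmem
  have hroot := eventually_exists_root_of_continuous (Φ := Φ)
    (by
      simp only [hΦ]
      refine continuous_finsetSum _ fun i _ => ?_
      exact ((hev _).continuous.comp continuous_snd).mul (by fun_prop))
    (fun w => by
      simp only [funext (hΦ w)]
      exact Differentiable.fun_sum fun i _ => (hev _).mul_const _)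
    hΦ00
    ⟨1, by
      rw [hΦ, Finset.sum_range_succ', hL1]
      simpa using hv⟩ hε
  filter_upwards [hroot, Metric.ball_mem_nhds 0 hε] with w hw hwε
  obtain ⟨t, ht, hΦt⟩ := hw
  obtain ⟨φ, hφF, hφA⟩ := exists_algHom_of_aeval_minpoly_eq_zero
    (aeval (L t) : MvPolynomial (Fin s) ℂ →ₐ[ℂ] ℂ) F w hΦt
  refine ⟨φ, hφF, hWU (show _ ∈ W from ?_)⟩
  have h1 : (fun j => φ (algebraMap (MvPolynomial (Fin s) ℂ) B (X j))) = L t := by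
    ext j
    rw [hφA, aeval_X]
  change ((fun j => φ (algebraMap (MvPolynomial (Fin s) ℂ) B (X j))), φ F) ∈ W
  rw [h1, hφF]
  exact hsub (Set.mk_mem_prod (by simpa using ht) hwε)

/-- A polynomial that vanishes at a point `x` of an irreducible algebraic set, but not on the whole
set, is an open function on this set at `x` in the classical topology. -/
theorem eventually_exists_mem_zeroLocus_aeval_eq {n : ℕ} {Q : Ideal (MvPolynomial (Fin n) ℂ)}
    [hQ : Q.IsPrime] {x : Fin n → ℂ} (hx : x ∈ zeroLocus ℂ Q) {f : MvPolynomial (Fin n) ℂ}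
    (hf : f ∉ Q) (hfx : aeval x f = 0) {U : Set (Fin n → ℂ)} (hU : U ∈ 𝓝 x) :
    ∀ᶠ w in 𝓝 (0 : ℂ), ∃ y ∈ zeroLocus ℂ Q, y ∈ U ∧ aeval y f = w := by
  have hmem (y : Fin n → ℂ) (p : MvPolynomial (Fin n) ℂ) :
      p ∈ (vanishingIdeal ℂ {y} : Ideal (MvPolynomial (Fin n) ℂ)) ↔ aeval y p = 0 :=
    mem_vanishingIdeal_singleton_iff y p
  obtain ⟨q, hq, hQq, hqM, hfq, hmin⟩ := Ideal.exists_isPrime_mem_minimalPrimes_sup_span_singleton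
    (M := vanishingIdeal ℂ {x}) (fun p hp => (hmem x p).2 (hx p hp)) ((hmem x f).2 hfx) hf
  -- remove the zeros of `f` other than `x`
  obtain ⟨h, hhx, hh⟩ := Ideal.exists_mem_minimalPrimes_notMem _ _ hmin
  have hisol (y : Fin n → ℂ) (hy : y ∈ zeroLocus ℂ q) (hfy : aeval y f = 0) (hhy : aeval y h ≠ 0) :
      y = x := by
    have hle : q ⊔ Ideal.span {f} ≤ vanishingIdeal ℂ {y} :=
      sup_le (fun p hp => (hmem y p).2 (hy p hp))
        ((Ideal.span_singleton_le_iff_mem _).2 ((hmem y f).2 hfy))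
    obtain ⟨p, hp, hpy⟩ := Ideal.exists_minimalPrimes_le hle
    have hpx : p = vanishingIdeal ℂ {x} := by
      by_contra hne
      exact hhy ((hmem y h).1 (hpy (hh p hp hne)))
    ext j
    have : X j - C (x j) ∈ (vanishingIdeal ℂ {x} : Ideal (MvPolynomial (Fin n) ℂ)) := by
      simp [hmem]
    have := (hmem y _).1 (hpy (hpx ▸ this))
    rw [map_sub, aeval_X, aeval_C] at this
    exact sub_eq_zero.1 this
  let S := MvPolynomial (Fin n) ℂ ⧸ q
  let hS : S := Ideal.Quotient.mk q h
  have : IsDomain S := Ideal.Quotient.isDomain q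
  have hS0 : hS ≠ 0 := fun h0 => hhx (hqM (Ideal.Quotient.eq_zero_iff_mem.1 h0))
  let B := Localization.Away hS
  have hpow : Submonoid.powers hS ≤ nonZeroDivisors S :=
    powers_le_nonZeroDivisors_of_noZeroDivisors hS0
  have : IsDomain B := IsLocalization.isDomain_localization hpow
  have : Algebra.FiniteType S B := IsLocalization.finiteType_of_monoid_fg (Submonoid.powers hS) B
  have : Algebra.FiniteType ℂ B := Algebra.FiniteType.trans (S := S) inferInstance inferInstance
  let π : MvPolynomial (Fin n) ℂ →ₐ[ℂ] B :=
    (IsScalarTower.toAlgHom ℂ S B).comp (Ideal.Quotient.mkₐ ℂ q)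
  have hπ (p : MvPolynomial (Fin n) ℂ) : π p = algebraMap S B (Ideal.Quotient.mk q p) := rfl
  have hinj : Function.Injective (algebraMap S B) := IsLocalization.injective B hpow
  have hF : π f ≠ 0 := by
    rw [hπ, Ne, map_eq_zero_iff _ hinj, Ideal.Quotient.eq_zero_iff_mem]
    exact hfq
  have hpt (φ : B →ₐ[ℂ] ℂ) (p : MvPolynomial (Fin n) ℂ) :
      φ (π p) = aeval (fun j => φ (π (X j))) p := by
    have : φ.comp π = aeval (fun j => φ (π (X j))) := by ext1 j; simp
    exact DFunLike.congr_fun this p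
  have hptq (φ : B →ₐ[ℂ] ℂ) : (fun j => φ (π (X j))) ∈ zeroLocus ℂ q := fun p hp => by
    rw [← hpt, hπ, Ideal.Quotient.eq_zero_iff_mem.2 hp, map_zero, map_zero]
  have hpth (φ : B →ₐ[ℂ] ℂ) : aeval (fun j => φ (π (X j))) h ≠ 0 := by
    rw [← hpt]
    exact ((IsLocalization.Away.algebraMap_isUnit (S := B) hS).map φ).ne_zero
  let φS : S →ₐ[ℂ] ℂ := Ideal.Quotient.liftₐ q (aeval x) fun p hp => (hmem x p).1 (hqM hp)
  let φ₀ : B →ₐ[ℂ] ℂ := IsLocalization.liftAlgHom (M := Submonoid.powers hS) (f := φS) (by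
    rintro ⟨_, k, rfl⟩
    rw [map_pow]
    exact (isUnit_iff_ne_zero.2 fun h0 => hhx ((hmem x h).2 h0)).pow k)
  have hφ₀π (p : MvPolynomial (Fin n) ℂ) : φ₀ (π p) = aeval x p := by
    rw [hπ]
    exact IsLocalization.lift_eq _ _
  have huniq (φ : B →ₐ[ℂ] ℂ) (hφ : φ (π f) = 0) : φ = φ₀ := by
    have hy := hisol _ (hptq φ) (by rwa [← hpt]) (hpth φ)
    refine AlgHom.coe_ringHom_injective (IsLocalization.ringHom_ext (Submonoid.powers hS) ?_)
    refine Ideal.Quotient.ringHom_ext ?_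
    refine RingHom.ext fun p => ?_
    change φ (π p) = φ₀ (π p)
    rw [hpt, hy, hφ₀π]
  have hU' : U ∈ 𝓝 fun k => φ₀ (π (X k)) := by
    simpa [hφ₀π] using hU
  filter_upwards [eventually_exists_algHom_apply_eq (π f) hF φ₀ (by rw [hφ₀π, hfx]) huniq
    (fun k => π (X k)) hU'] with w hw
  obtain ⟨φ, hφw, hφU⟩ := hw
  exact ⟨_, zeroLocus_anti_mono hQq (hptq φ), hφU, by rw [← hpt, hφw]⟩

/-! ### Jacobian minors and isosingular deflation -/

lemma aeval_map_algebraMap_real {n : ℕ} (x : Fin n → ℂ) (h : MvPolynomial (Fin n) ℝ) :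
    aeval x (map (algebraMap ℝ ℂ) h) = aeval x h :=
  aeval_map_algebraMap ℂ x h

lemma gradientAt_map_algebraMap_real {n : ℕ} (x : Fin n → ℂ) (h : MvPolynomial (Fin n) ℝ) :
    gradientAt (map (algebraMap ℝ ℂ) h) x = gradientAt h x := by
  ext j
  rw [gradientAt, pderiv_map, aeval_map_algebraMap_real, gradientAt]

lemma linearIndependent_gradientAt_of_jacobianMinor_ne_zero {n m : ℕ} {x : Fin n → ℂ}
    {r : Fin m → MvPolynomial (Fin n) ℝ} {c : Fin m → Fin n}
    (h : aeval x (jacobianMinor r c) ≠ 0) :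
    LinearIndependent ℂ fun a => gradientAt (r a) x := by
  have hdet : (Matrix.of fun a b => gradientAt (r a) x (c b)).det ≠ 0 := by
    rw [jacobianMinor, AlgHom.map_det] at h
    exact h
  have hrows := Matrix.linearIndependent_rows_of_det_ne_zero hdet
  exact LinearIndependent.of_comp (LinearMap.funLeft ℂ ℂ c) hrows

lemma le_jacobianRank_of_linearIndependent {n m : ℕ} {x : Fin n → ℂ}
    {G : Set (MvPolynomial (Fin n) ℝ)} {r : Fin m → MvPolynomial (Fin n) ℝ} (hr : ∀ a, r a ∈ G)
    (h : LinearIndependent ℂ fun a => gradientAt (r a) x) : m ≤ jacobianRank G x := by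
  have h1 := finrank_span_eq_card h
  rw [Fintype.card_fin] at h1
  rw [← h1]
  refine Submodule.finrank_mono (Submodule.span_mono ?_)
  rintro _ ⟨a, rfl⟩
  exact ⟨r a, hr a, rfl⟩

/-- Deflation at a general point of `V` does not remove points of `V`, because the rank of the
Jacobian matrix on `V` does not exceed its rank at the general point. -/
lemma subset_commonZeros_deflationSequence {n : ℕ} {V : Set (Fin n → ℂ)}
    {G₀ : Set (MvPolynomial (Fin n) ℝ)} (hG₀V : V ⊆ commonZeros G₀) {k : ℕ} {p : Fin n → ℂ}
    (hp : IsGeneralPoint V G₀ k p) {j : ℕ} (hj : j ≤ k) :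
    V ⊆ commonZeros (deflationSequence p G₀ j) := by
  induction j with
  | zero => exact hG₀V
  | succ j ih =>
    intro x hx h hh
    rw [deflationSequence, Function.iterate_succ_apply'] at hh
    rcases hh with hh | ⟨r, c, hr, -, -, rfl⟩
    · exact ih (by omega) hx h hh
    · by_contra hne
      have h1 := le_jacobianRank_of_linearIndependent hr
        (linearIndependent_gradientAt_of_jacobianMinor_ne_zero hne)
      have h2 := hp.2 j (by omega) x hx
      rw [deflationSequence] at h2
      omega

/-- Where an `m × m` minor of the Jacobian matrix of equations of `V` does not vanish, the tangent
space of `V` has codimension at least `m`. -/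
lemma finrank_tangentSpaceAt_add_le {n m : ℕ} {V : Set (Fin n → ℂ)} {x : Fin n → ℂ}
    {r : Fin m → MvPolynomial (Fin n) ℝ} (hr : ∀ a, ∀ y ∈ V, aeval y (r a) = 0)
    {c : Fin m → Fin n} (h : aeval x (jacobianMinor r c) ≠ 0) :
    Module.finrank ℂ (tangentSpaceAt V x) + m ≤ n := by
  have hind := linearIndependent_gradientAt_of_jacobianMinor_ne_zero h
  have h1 := finrank_span_eq_card hind
  rw [Fintype.card_fin] at h1
  have h2 : m ≤ Module.finrank ℂ (conormalSpaceAt V x) := by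
    rw [← h1]
    refine Submodule.finrank_mono (Submodule.span_le.2 ?_)
    rintro _ ⟨a, rfl⟩
    change gradientAt (r a) x ∈ conormalSpaceAt V x
    rw [← gradientAt_map_algebraMap_real]
    refine gradientAt_mem_conormalSpaceAt fun y hy => ?_
    rw [aeval_map_algebraMap_real]
    exact hr a y hy
  have h3 := finrank_conormalSpaceAt_add_finrank_tangentSpaceAt V x
  omega

/-! ### The limit of the polar varieties -/

lemma mem_polarVariety_perturb_iff {n : ℕ} {f : MvPolynomial (Fin n) ℝ} {w : ℂ} {i : ℕ}
    {y : Fin n → ℂ} :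
    y ∈ polarVariety (perturb f w) i ↔ aeval y (map (algebraMap ℝ ℂ) f) = w ∧
      ∀ j : Fin n, i ≤ j.val → aeval y (pderiv j (map (algebraMap ℝ ℂ) f)) = 0 := by
  have hd (j : Fin n) : pderiv j (perturb f w) = pderiv j (map (algebraMap ℝ ℂ) f) := by
    simp [perturb]
  constructor
  · intro h
    refine ⟨?_, fun j hj => ?_⟩
    · have := h _ (Or.inl rfl)
      rwa [perturb, map_sub, aeval_C, sub_eq_zero] at this
    · rw [← hd]
      exact h _ (Or.inr ⟨j, hj, rfl⟩)
  · rintro ⟨h1, h2⟩ q (rfl | ⟨j, hj, rfl⟩)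
    · rw [perturb, map_sub, aeval_C, h1]
      exact sub_self w
    · rw [hd]
      exact h2 j hj

lemma isClosed_zeroLocus {n : ℕ} (I : Ideal (MvPolynomial (Fin n) ℂ)) :
    IsClosed (zeroLocus ℂ I) := by
  have : zeroLocus ℂ I = ⋂ p ∈ I, {x : Fin n → ℂ | eval x p = 0} := by
    ext x
    simp [mem_zeroLocus_iff, aeval_eq_eval]
  rw [this]
  exact isClosed_biInter fun p _ => isClosed_eq (MvPolynomial.continuous_eval p) continuous_const

/-- The polar locus `∂f/∂x_{j+1} = 0`, `j ≥ i`, as an ideal: the union of all the polar varieties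
of the level sets of `f`. -/
noncomputable def polarIdeal {n : ℕ} (f : MvPolynomial (Fin n) ℂ) (i : ℕ) :
    Ideal (MvPolynomial (Fin n) ℂ) :=
  Ideal.span ((Finset.univ.filter fun j : Fin n => i ≤ j.val).image fun j => pderiv j f :
    Finset (MvPolynomial (Fin n) ℂ))

lemma polarIdeal_le_vanishingIdeal_singleton_iff {n : ℕ} {f : MvPolynomial (Fin n) ℂ} {i : ℕ}
    {y : Fin n → ℂ} :
    polarIdeal f i ≤ vanishingIdeal ℂ {y} ↔ ∀ j : Fin n, i ≤ j.val → aeval y (pderiv j f) = 0 := by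
  rw [polarIdeal, Ideal.span_le]
  constructor
  · intro h j hj
    exact (mem_vanishingIdeal_singleton_iff y _).1 (h (by simpa using ⟨j, hj, rfl⟩))
  · intro h q hq
    obtain ⟨j, hj, rfl⟩ : ∃ j : Fin n, i ≤ j.val ∧ pderiv j f = q := by simpa using hq
    exact (mem_vanishingIdeal_singleton_iff y _).2 (h j hj)

lemma le_vanishingIdeal_singleton_iff {n : ℕ} {I : Ideal (MvPolynomial (Fin n) ℂ)}
    {y : Fin n → ℂ} : I ≤ vanishingIdeal ℂ {y} ↔ y ∈ zeroLocus ℂ I := by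
  rw [← le_zeroLocus_iff_le_vanishingIdeal]
  exact Set.singleton_subset_iff

/-- The limit of the polar varieties lies on the zero level of `f` in those components of the polar
locus on which `f` does not vanish identically. -/
lemma exists_minimalPrimes_of_mem_limitAtZero {n : ℕ} {i : ℕ} {f : MvPolynomial (Fin n) ℝ} {ξ : ℂ}
    (hξ : ξ ≠ 0) {x : Fin n → ℂ}
    (hx : x ∈ limitAtZero fun t : ℝ => polarVariety (perturb f (t * ξ)) i) :
    aeval x (map (algebraMap ℝ ℂ) f) = 0 ∧
      ∃ Q ∈ (polarIdeal (map (algebraMap ℝ ℂ) f) i).minimalPrimes,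
        map (algebraMap ℝ ℂ) f ∉ Q ∧ x ∈ zeroLocus ℂ Q := by
  obtain ⟨t, y, hty, ht, hy⟩ := hx
  simp only [mem_polarVariety_perturb_iff] at hty
  constructor
  · have h1 : Tendsto (fun k => aeval (y k) (map (algebraMap ℝ ℂ) f)) atTop
        (𝓝 (aeval x (map (algebraMap ℝ ℂ) f))) := by
      simp only [aeval_eq_eval]
      exact ((MvPolynomial.continuous_eval _).tendsto x).comp hy
    have h2 : Tendsto (fun k => (t k : ℂ) * ξ) atTop (𝓝 0) := by
      have := ((Complex.continuous_ofReal.tendsto 0).comp ht).mul_const ξ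
      simpa using this
    refine tendsto_nhds_unique h1 ?_
    simpa only [(hty _).2.2.1] using h2
  · have hfin := Ideal.finite_minimalPrimes_of_isNoetherianRing _
      (polarIdeal (map (algebraMap ℝ ℂ) f) i)
    -- infinitely many of the approximating points lie in the same component
    obtain ⟨Q, hQ, hfreq⟩ : ∃ Q ∈ (polarIdeal (map (algebraMap ℝ ℂ) f) i).minimalPrimes,
        ∃ᶠ k in atTop, y k ∈ zeroLocus ℂ Q := by
      by_contra! hcon
      have hall := (eventually_all_finite hfin).2 hcon
      obtain ⟨k, hk⟩ := hall.exists
      obtain ⟨Q, hQ, hQy⟩ := Ideal.exists_minimalPrimes_le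
        (polarIdeal_le_vanishingIdeal_singleton_iff.2 (hty k).2.2.2)
      exact hk Q hQ (le_vanishingIdeal_singleton_iff.1 hQy)
    refine ⟨Q, hQ, fun hfQ => ?_, (isClosed_zeroLocus Q).mem_of_frequently_of_tendsto hfreq hy⟩
    obtain ⟨k, hk⟩ := hfreq.exists
    have := hk _ hfQ
    rw [(hty k).2.2.1] at this
    exact mul_ne_zero (Complex.ofReal_ne_zero.2 (hty k).1.ne') hξ this

/-- Conversely, the limit of the polar varieties contains the zero level of `f` in these components,
because `f` is an open function on each of them. -/
lemma mem_limitAtZero_of_mem_zeroLocus {n : ℕ} {i : ℕ} {f : MvPolynomial (Fin n) ℝ} {ξ : ℂ}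
    {Q : Ideal (MvPolynomial (Fin n) ℂ)}
    (hQ : Q ∈ (polarIdeal (map (algebraMap ℝ ℂ) f) i).minimalPrimes)
    (hfQ : map (algebraMap ℝ ℂ) f ∉ Q) {x : Fin n → ℂ} (hx : x ∈ zeroLocus ℂ Q)
    (hfx : aeval x (map (algebraMap ℝ ℂ) f) = 0) :
    x ∈ limitAtZero fun t : ℝ => polarVariety (perturb f (t * ξ)) i := by
  have := hQ.isPrime
  have key (m : ℕ) : ∃ (t : ℝ) (y : Fin n → ℂ), (0 < t ∧ t ≤ 1 ∧
      y ∈ polarVariety (perturb f (t * ξ)) i) ∧ t < 1 / ((m : ℝ) + 1) ∧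
        dist y x < 1 / ((m : ℝ) + 1) := by
    have hm : (0 : ℝ) < 1 / ((m : ℝ) + 1) := by positivity
    have h1 := eventually_exists_mem_zeroLocus_aeval_eq hx hfQ hfx (Metric.ball_mem_nhds x hm)
    have h2 : Tendsto (fun t : ℝ => (t : ℂ) * ξ) (𝓝[>] 0) (𝓝 0) := by
      have := (Complex.continuous_ofReal.tendsto 0).mul_const ξ
      rw [Complex.ofReal_zero, zero_mul] at this
      exact this.mono_left nhdsWithin_le_nhds
    have h3 : ∀ᶠ t : ℝ in 𝓝[>] 0, t ∈ Set.Ioo (0 : ℝ) (min 1 (1 / ((m : ℝ) + 1))) :=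
      Ioo_mem_nhdsGT (lt_min one_pos hm)
    obtain ⟨t, ⟨y, hyQ, hyx, hyf⟩, ht0, ht1⟩ := ((h2.eventually h1).and h3).exists
    refine ⟨t, y, ⟨ht0, (ht1.trans_le (min_le_left _ _)).le, ?_⟩,
      ht1.trans_le (min_le_right _ _), hyx⟩
    exact mem_polarVariety_perturb_iff.2 ⟨hyf, polarIdeal_le_vanishingIdeal_singleton_iff.1
      (hQ.le.trans (le_vanishingIdeal_singleton_iff.2 hyQ))⟩
  choose t y hty htm hym using key
  have hlim := tendsto_one_div_add_atTop_nhds_zero_nat (𝕜 := ℝ)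
  exact ⟨t, y, hty, squeeze_zero (fun m => (hty m).1.le) (fun m => (htm m).le) hlim,
    tendsto_iff_dist_tendsto_zero.2
      (squeeze_zero (fun m => dist_nonneg) (fun m => (hym m).le) hlim)⟩

/-- If `Q` is a component of the zero set of `r` equations and `P` is a component of its intersection
with a hypersurface that does not contain it, then the codimension of `P` is at most `r + 1`. -/
lemma le_ringKrullDim_quotient_of_minimalPrimes_sup_span_singleton {n : ℕ}
    {s : Finset (MvPolynomial (Fin n) ℂ)} {f : MvPolynomial (Fin n) ℂ}
    {Q P : Ideal (MvPolynomial (Fin n) ℂ)}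
    (hQ : Q ∈ (Ideal.span (s : Set (MvPolynomial (Fin n) ℂ))).minimalPrimes)
    (hP : P ∈ (Q ⊔ Ideal.span {f}).minimalPrimes) :
    (n : WithBot ℕ∞) ≤ ringKrullDim (MvPolynomial (Fin n) ℂ ⧸ P) + 1 + s.card := by
  have := hQ.isPrime
  have := hP.isPrime
  have hQP : Q ≤ P := le_sup_left.trans hP.le
  have h1 := ringKrullDim_le_ringKrullDim_quotient_minimalPrime_add_card s Q hQ
  have hmin : P.map (Ideal.Quotient.mk Q) ∈
      (Ideal.span (({Ideal.Quotient.mk Q f} : Finset (_ ⧸ Q)) : Set (_ ⧸ Q))).minimalPrimes := by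
    refine ⟨⟨Ideal.isPrime_map_quotientMk_of_isPrime hQP, ?_⟩, fun q hq hqP => ?_⟩
    · rw [Finset.coe_singleton, Ideal.span_singleton_le_iff_mem]
      exact Ideal.mem_map_of_mem _ (hP.le (Ideal.mem_sup_right (Ideal.mem_span_singleton_self f)))
    · have := hq.1
      rw [Finset.coe_singleton, Ideal.span_singleton_le_iff_mem] at hq
      have hqP' : q.comap (Ideal.Quotient.mk Q) ≤ P := by
        rw [← Ideal.comap_map_mk hQP]
        exact Ideal.comap_mono hqP
      rw [Ideal.map_le_iff_le_comap]
      refine hP.2 ⟨inferInstance, sup_le (fun a ha => ?_) ?_⟩ hqP'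
      · rw [Ideal.mem_comap, Ideal.Quotient.eq_zero_iff_mem.2 ha]
        exact q.zero_mem
      · exact (Ideal.span_singleton_le_iff_mem _).2 hq.2
  have h2 := ringKrullDim_le_ringKrullDim_quotient_minimalPrime_add_card _ _ hmin
  rw [ringKrullDim_eq_of_ringEquiv (DoubleQuot.quotQuotEquivQuotOfLE hQP), Finset.card_singleton,
    Nat.cast_one] at h2
  have h3 : ringKrullDim (MvPolynomial (Fin n) ℂ) = n := by
    simp [MvPolynomial.ringKrullDim_of_isNoetherianRing]
  rw [h3] at h1
  exact h1.trans (by gcongr)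

/-- The components of the limit of the polar varieties have dimension at least `i - 1`: they are
components of the zero level of `f` in a component of the polar locus. -/
lemma le_algDim_add_one_of_isIrreducibleComponent_limitAtZero {n : ℕ} {i : ℕ} (hin : i ≤ n)
    {f : MvPolynomial (Fin n) ℝ} {ξ : ℂ} (hξ : ξ ≠ 0) {V : Set (Fin n → ℂ)}
    (hV : IsIrreducibleComponent V
      (limitAtZero fun t : ℝ => polarVariety (perturb f (t * ξ)) i)) :
    (i : WithBot ℕ∞) ≤ algDim V + 1 := by
  classical
  obtain ⟨⟨⟨hVz, hVp⟩, hVL⟩, hVmax⟩ := hV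
  set fC := map (algebraMap ℝ ℂ) f with hfC
  have hfin := Ideal.finite_minimalPrimes_of_isNoetherianRing _ (polarIdeal fC i)
  let s := hfin.toFinset.filter fun Q => fC ∉ Q
  have hle : s.inf (fun Q => Q ⊔ Ideal.span {fC}) ≤ vanishingIdeal ℂ V := by
    intro p hp x hx
    obtain ⟨hfx, Q, hQ, hfQ, hxQ⟩ := exists_minimalPrimes_of_mem_limitAtZero hξ (hVL hx)
    have hpQ := Finset.inf_le (f := fun Q => Q ⊔ Ideal.span {fC})
      (by simpa [s] using ⟨hQ, hfQ⟩ : Q ∈ s) hp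
    exact (mem_vanishingIdeal_singleton_iff x p).1 (sup_le (le_vanishingIdeal_singleton_iff.2 hxQ)
      ((Ideal.span_singleton_le_iff_mem _).2 ((mem_vanishingIdeal_singleton_iff x _).2 hfx)) hpQ)
  obtain ⟨Q, hQs, hQV⟩ := (Ideal.IsPrime.inf_le' hVp).1 hle
  obtain ⟨hQ, hfQ⟩ : Q ∈ (polarIdeal fC i).minimalPrimes ∧ fC ∉ Q := by simpa [s] using hQs
  obtain ⟨P, hP, hPV⟩ := Ideal.exists_minimalPrimes_le hQV
  have := hP.isPrime
  have hPz : vanishingIdeal ℂ (zeroLocus ℂ P) = P := IsPrime.vanishingIdeal_zeroLocus P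
  have hPL : zeroLocus ℂ P ⊆ limitAtZero fun t : ℝ => polarVariety (perturb f (t * ξ)) i :=
    fun x hx => mem_limitAtZero_of_mem_zeroLocus hQ hfQ
      (fun p hp => hx p (hP.le (Ideal.mem_sup_left hp)))
      (hx _ (hP.le (Ideal.mem_sup_right (Ideal.mem_span_singleton_self _))))
  have hVP : V ⊆ zeroLocus ℂ P := by
    rw [← hVz]
    exact zeroLocus_anti_mono hPV
  have hPV' : zeroLocus ℂ P ⊆ V :=
    hVmax ⟨⟨by rw [hPz], by rwa [hPz]⟩, hPL⟩ hVP
  have hVI : vanishingIdeal ℂ V = P := by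
    rw [Set.Subset.antisymm hVP hPV', hPz]
  have hdim := le_ringKrullDim_quotient_of_minimalPrimes_sup_span_singleton hQ hP
  have hcard : ((Finset.univ.filter fun j : Fin n => i ≤ j.val).image
      fun j => pderiv j fC).card ≤ n - i := by
    refine Finset.card_image_le.trans ?_
    rw [← Nat.card_Ico]
    refine Finset.card_le_card_of_injOn Fin.val (fun j hj => ?_) Fin.val_injective.injOn
    simpa using hj
  rw [algDim, hVI]
  have hdim' : (n : WithBot ℕ∞) ≤
      ringKrullDim (MvPolynomial (Fin n) ℂ ⧸ P) + 1 + ((n - i : ℕ) : WithBot ℕ∞) :=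
    hdim.trans (by gcongr)
  generalize ringKrullDim (MvPolynomial (Fin n) ℂ ⧸ P) = d at hdim'
  induction d with
  | bot => simp at hdim'
  | coe d =>
    induction d with
    | top => exact le_top
    | coe d =>
      have h1 : ((n : ℕ∞) : WithBot ℕ∞) ≤ ((d + 1 + (n - i : ℕ) : ℕ∞) : WithBot ℕ∞) := hdim'
      have h2 : n ≤ d + 1 + (n - i) := by exact_mod_cast WithBot.coe_le_coe.1 h1
      have h3 : (i : ℕ∞) ≤ d + 1 := by exact_mod_cast (by omega : i ≤ d + 1)
      exact WithBot.coe_le_coe.2 h3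

end Limit

/-! ### Singular points and the minor -/

theorem mainTheorem7 {n : ℕ} (i : ℕ) (hi : 1 ≤ i) (hin : i ≤ n)
    (f : MvPolynomial (Fin n) ℝ) (ξ : ℂ) (hξ : ‖ξ‖ = 1)
    -- each perturbed polar variety is empty, or smooth and equidimensional of dimension `i - 1`
    (hpolar : ∀ t : ℝ, 0 < t → t ≤ 1 →
      polarVariety (perturb f (t * ξ)) i = ∅ ∨
      (IsEquidimensional (polarVariety (perturb f (t * ξ)) i) (i - 1) ∧
        ∀ y ∈ polarVariety (perturb f (t * ξ)) i,
          IsNonsingularPoint (polarVariety (perturb f (t * ξ)) i) y))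
    (V : Set (Fin n → ℂ))
    (hV : IsIrreducibleComponent V
      (limitAtZero fun t : ℝ => polarVariety (perturb f (t * ξ)) i))
    (z : Fin n → ℂ) (hz : IsNonsingularPoint V z)
    -- `F` is a term of the isosingular deflation sequence, at a general point of `V`, of a system
    -- that contains the polar equations and vanishes on `V`
    (G₀ : Set (MvPolynomial (Fin n) ℝ)) (hfin : G₀.Finite)
    (hG₀ : polarEquations f i ⊆ G₀) (hG₀V : V ⊆ commonZeros G₀)
    (k : ℕ) (p : Fin n → ℂ) (hp : IsGeneralPoint V G₀ k p)
    (F : Set (MvPolynomial (Fin n) ℝ)) (hF : F = deflationSequence p G₀ k)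
    (hrank : jacobianRank F z = n - i + 1)
    -- a maximal minor of `JF` that does not vanish at `z`
    (r : Fin (n - i + 1) → MvPolynomial (Fin n) ℝ) (hr : ∀ a, r a ∈ F)
    (c : Fin (n - i + 1) → Fin n)
    (g : MvPolynomial (Fin n) ℝ) (hg : g = jacobianMinor r c)
    (hgz : MvPolynomial.aeval z g ≠ 0) :
    singularLocus V ⊆ commonZeros {g} ∧
    algDim (V ∩ commonZeros {g}) + 2 ≤ (i : WithBot ℕ∞) := by
  subst hg
  have hVp : (vanishingIdeal ℂ V).IsPrime := hV.prop.1.2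
  have hξ0 : ξ ≠ 0 := norm_ne_zero_iff.1 (by rw [hξ]; exact one_ne_zero)
  have hlow := le_algDim_add_one_of_isIrreducibleComponent_limitAtZero hin hξ0 hV
  have hrV : ∀ a, ∀ y ∈ V, aeval y (r a) = 0 := fun a y hy =>
    subset_commonZeros_deflationSequence hG₀V hp le_rfl hy _ (hF ▸ hr a)
  have hupper {x : Fin n → ℂ} (hgx : aeval x (jacobianMinor r c) ≠ 0) :
      Module.finrank ℂ (tangentSpaceAt V x) + 1 ≤ i := by
    have := finrank_tangentSpaceAt_add_le hrV hgx
    omega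
  -- the dimension of `V` is `i - 1`
  have hdim : algDim V = ((i - 1 : ℕ) : WithBot ℕ∞) := by
    have h1 := hupper hgz
    rw [← hz.2] at hlow ⊢
    have h2 : i ≤ Module.finrank ℂ (tangentSpaceAt V z) + 1 := by exact_mod_cast hlow
    congr 1
    omega
  constructor
  · rintro x ⟨hxV, hxs⟩ _ rfl
    by_contra hgx
    refine hxs ⟨hxV, le_antisymm ?_ (algDim_le_finrank_tangentSpaceAt hVp hxV)⟩
    rw [hdim]
    have := hupper hgx
    exact_mod_cast (by omega : Module.finrank ℂ (tangentSpaceAt V x) ≤ i - 1)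
  · set J := vanishingIdeal ℂ (V ∩ commonZeros {jacobianMinor r c})
    set P := vanishingIdeal ℂ V
    have hPJ : P ≤ J := vanishingIdeal_anti_mono Set.inter_subset_left
    let γ : MvPolynomial (Fin n) ℂ := map (algebraMap ℝ ℂ) (jacobianMinor r c)
    have hγJ : γ ∈ J := fun x hx => by
      rw [aeval_map_algebraMap_real]
      exact hx.2 _ rfl
    have hγP : γ ∉ P := fun h => hgz (by
      rw [← aeval_map_algebraMap_real]
      exact h z hz.1)
    have : IsDomain (MvPolynomial (Fin n) ℂ ⧸ P) := Ideal.Quotient.isDomain P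
    have hsucc : ringKrullDim (MvPolynomial (Fin n) ℂ ⧸ J) + 1 ≤
        ringKrullDim (MvPolynomial (Fin n) ℂ ⧸ P) :=
      ringKrullDim_succ_le_of_surjective (Ideal.Quotient.factor hPJ)
        (Ideal.Quotient.factor_surjective hPJ) (r := Ideal.Quotient.mk P γ)
        (mem_nonZeroDivisors_of_ne_zero fun h => hγP (Ideal.Quotient.eq_zero_iff_mem.1 h))
        (by rw [Ideal.Quotient.factor_mk]; exact Ideal.Quotient.eq_zero_iff_mem.2 hγJ)
    have hdim' : ringKrullDim (MvPolynomial (Fin n) ℂ ⧸ P) = ((i - 1 : ℕ) : WithBot ℕ∞) := hdim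
    rw [hdim'] at hsucc
    calc algDim (V ∩ commonZeros {jacobianMinor r c}) + 2
        = ringKrullDim (MvPolynomial (Fin n) ℂ ⧸ J) + 1 + 1 := by
          rw [add_assoc, one_add_one_eq_two]; rfl
      _ ≤ ((i - 1 : ℕ) : WithBot ℕ∞) + 1 := by gcongr
      _ = i := by exact_mod_cast congrArg (Nat.cast (R := WithBot ℕ∞)) (Nat.sub_add_cancel hi)
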